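/- Let $d\ge 2$. A canonical basis of the $d\times d$ complex matrices is a family $G_0,\dots,G_{d^2-1}$ that is orthonormal for $\langle X,Y\rangle=\mathrm{Tr}(X^\dagger Y)$, with $G_0=I_d/\sqrt d$ and all other $G_a$ traceless. For canonical bases $(G^A_a),(G^B_b)$ and a state (density matrix) $\rho$ on $\mathbb C^d\otimes\mathbb C^d$ put $C^{can}_{a,b}(\rho)=\mathrm{Tr}(\rho\,G^A_a\otimes G^B_b)$; this $d^2\times d^2$ matrix is regarded as an operator on $\mathbb C^d\otimes\mathbb C^d$, the computational basis $|ij\rangle$ being enumerated lexicographically (position $id+j$). Let $\|\cdot\|_1$ be the sum of the singular values, $k(\rho)=\det(I_d+\mathrm{Tr}_A\rho)-\det(I_{d^2}+\rho)$, $\lambda_{\max}(\rho)$ the largest eigenvalue of $\rho$, and $$W_L^{DV}(\rho)=\Big(\frac{d(d-1)}2-d^2(d+1)^2\,k(\rho)\Big)I_{d^2}-\frac{1}{\lambda_{\max}(\rho)}\,C^{can}(\rho).$$ For all $d\ge2$ and all canonical bases, the operator $W_L^{DV}(\rho)$, which depends on the state $\rho$ under investigation, satisfies the two witness conditions when evaluated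 on that state: (i) for every separable state $\rho$ one has $\|C^{can}(\rho)\|_1\le d(d-1)/2$ and $\mathrm{Re}\,\mathrm{Tr}(W_L^{DV}(\rho)\,\rho)\ge 0$; (ii) there is an entangled (that is, non-separable) state $\rho$ with $\mathrm{Re}\,\mathrm{Tr}(W_L^{DV}(\rho)\,\rho)<0$; if all $G^A_a,G^B_b$ are Hermitian, then $\rho$ can be chosen such that moreover $\mathrm{Tr}(W_L^{DV}(\rho)\,\rho)$ is real and, if in addition $G^A_a=G^B_a$ for all $a$, $W_L^{DV}(\rho)$ is Hermitian. Now let $d=3$, let $\tau_1,\dots,\tau_8$ be the Gell-Mann matrices in the order: symmetric ($01,02,12$), antisymmetric ($01,02,12$), $\mathrm{diag}(1,-1,0)$, $\mathrm{diag}(1,1,-2)/\sqrt3$, and use for both factors the family $I_3/\sqrt3,\tau_1/\sqrt2,\dots,\tau_8/\sqrt2$, which is a canonical basis of Hermitian matrices. Let $$\rho_\beta=\frac1{5+2\beta^2}\sum_{i=1}^3|\epsilon_i\rangle\langle\epsilon_i|,\quad |\epsilon_i\rangle=|0i\rangle-\beta|i0\rangle\ (i=1,2),\quad |\epsilon_3\rangle=\sum_{j=0}^2|jj\rangle.$$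 For every $\beta\in[1/\sqrt2,1]$, $\rho_\beta$ is an entangled state that is not detected by the criterion $\|C^{can}\|_1\le d(d-1)/2$, that is, $\|C^{can}(\rho_\beta)\|_1\le 3$. For every $\beta\in[0.7308,0.7889]$, $\mathrm{Tr}(W_L^{DV}(\rho_\beta)\,\rho_\beta)$ is real and negative. -/

import Mathlib

open scoped Kronecker ComplexOrder

noncomputable section

/-- Operators on `ℂᵈ ⊗ ℂᵈ`, as matrices indexed by pairs: the pair `(i, j)` is the ket `|i j⟩`. -/
abbrev BipartiteOp (d : ℕ) : Type := Matrix (Fin d × Fin d) (Fin d × Fin d) ℂ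

/-- Density matrices. -/
def IsDensityMatrix {n : Type*} [Fintype n] (ρ : Matrix n n ℂ) : Prop :=
  ρ.PosSemidef ∧ ρ.trace = 1

/-- Separable states: finite convex combinations of product states. -/
def IsSeparableState {d : ℕ} (ρ : BipartiteOp d) : Prop :=
  ∃ (m : ℕ) (p : Fin m → ℝ) (A B : Fin m → Matrix (Fin d) (Fin d) ℂ),
    (∀ j, 0 ≤ p j) ∧ ∑ j, p j = 1 ∧
    (∀ j, IsDensityMatrix (A j)) ∧ (∀ j, IsDensityMatrix (B j)) ∧
    ρ = ∑ j, (p j : ℂ) • (A j ⊗ₖ B j)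

/-- Entangled states: states that are not separable. -/
def IsEntangledState {d : ℕ} (ρ : BipartiteOp d) : Prop :=
  IsDensityMatrix ρ ∧ ¬ IsSeparableState ρ

/-- The partial trace over the first tensor factor. -/
def partialTraceA {d : ℕ} (ρ : BipartiteOp d) : Matrix (Fin d) (Fin d) ℂ :=
  Matrix.of fun j l => ∑ i, ρ (i, j) (i, l)

/-- The number `k = det (I + Tr_A ρ) - det (I + ρ)`. -/
def detGap {d : ℕ} (ρ : BipartiteOp d) : ℂ :=
  (1 + partialTraceA ρ).det - (1 + ρ).det

/-- The largest eigenvalue (of a Hermitian matrix). -/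
def lambdaMax {n : Type*} [Fintype n] [DecidableEq n] (A : Matrix n n ℂ) : ℝ :=
  sSup (spectrum ℝ A)

/-- The trace norm: the sum of the singular values. -/
def traceNorm {n : Type*} [Fintype n] [DecidableEq n] (A : Matrix n n ℂ) : ℝ :=
  ∑ i, √((Matrix.isHermitian_conjTranspose_mul_self A).eigenvalues i)

/-- Canonical bases of the `d × d` matrices: orthonormal for the Hilbert-Schmidt inner product,
the first element is `I / √d` and all others are traceless. The `d²` elements are enumerated by
`Fin d × Fin d` in lexicographic order (so `(i, j)` is position `i * d + j`), which is also the
order of the computational basis of `ℂᵈ ⊗ ℂᵈ`. -/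
structure IsCanonicalBasis {d : ℕ} (G : Fin d × Fin d → Matrix (Fin d) (Fin d) ℂ) : Prop where
  orthonormal : ∀ a b, ((G a).conjTranspose * G b).trace = if a = b then 1 else 0
  first : ∀ a : Fin d × Fin d, (a.1 : ℕ) = 0 → (a.2 : ℕ) = 0 → G a = ((1 / √(d : ℝ) : ℝ) : ℂ) • 1
  traceless : ∀ a : Fin d × Fin d, ¬ ((a.1 : ℕ) = 0 ∧ (a.2 : ℕ) = 0) → (G a).trace = 0

/-- The correlation matrix `C a b = Tr (ρ (GA a ⊗ GB b))`. It has `d²` rows and columns and is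
regarded as an operator on `ℂᵈ ⊗ ℂᵈ` through the lexicographic enumeration. -/
def correlationMatrix {d : ℕ} (GA GB : Fin d × Fin d → Matrix (Fin d) (Fin d) ℂ)
    (ρ : BipartiteOp d) : BipartiteOp d :=
  Matrix.of fun a b => (ρ * (GA a ⊗ₖ GB b)).trace

/-- The bound `d (d - 1) / 2`. -/
def dvBound (d : ℕ) : ℝ := (d : ℝ) * ((d : ℝ) - 1) / 2

/-- The state `ρ` violates the criterion `‖C‖₁ ≤ d (d - 1) / 2`. -/
def DetectedByDV {d : ℕ} (GA GB : Fin d × Fin d → Matrix (Fin d) (Fin d) ℂ)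
    (ρ : BipartiteOp d) : Prop :=
  dvBound d < traceNorm (correlationMatrix GA GB ρ)

/-- The operator
`(d (d - 1) / 2 - d² (d + 1)² k) I - (1 / λ_max(ρ)) C`
built from the state `ρ` under investigation. -/
def witnessDV {d : ℕ} (GA GB : Fin d × Fin d → Matrix (Fin d) (Fin d) ℂ)
    (ρ : BipartiteOp d) : BipartiteOp d :=
  ((dvBound d : ℂ) - (d : ℂ) ^ 2 * ((d : ℂ) + 1) ^ 2 * detGap ρ) • (1 : BipartiteOp d)
    - ((1 / lambdaMax ρ : ℝ) : ℂ) • correlationMatrix GA GB ρ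

/-- The value `Tr (W ρ)` of the operator on the state it is built from. -/
def witnessValue {d : ℕ} (GA GB : Fin d × Fin d → Matrix (Fin d) (Fin d) ℂ)
    (ρ : BipartiteOp d) : ℂ :=
  (witnessDV GA GB ρ * ρ).trace

/-- The eight Gell-Mann matrices: first the symmetric ones, then the antisymmetric ones, then the
diagonal ones. -/
def gellMann : Fin 8 → Matrix (Fin 3) (Fin 3) ℂ :=
  ![!![0, 1, 0; 1, 0, 0; 0, 0, 0],
    !![0, 0, 1; 0, 0, 0; 1, 0, 0],
    !![0, 0, 0; 0, 0, 1; 0, 1, 0],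
    !![0, -Complex.I, 0; Complex.I, 0, 0; 0, 0, 0],
    !![0, 0, -Complex.I; 0, 0, 0; Complex.I, 0, 0],
    !![0, 0, 0; 0, 0, -Complex.I; 0, Complex.I, 0],
    !![1, 0, 0; 0, -1, 0; 0, 0, 0],
    ((1 / √3 : ℝ) : ℂ) • !![1, 0, 0; 0, 1, 0; 0, 0, -2]]

/-- The canonical basis `I/√3, τ₁/√2, …, τ₈/√2` of the `3 × 3` matrices. -/
def gellMannBasis (a : Fin 3 × Fin 3) : Matrix (Fin 3) (Fin 3) ℂ :=
  let s : ℂ := ((1 / √2 : ℝ) : ℂ)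
  (![![((1 / √3 : ℝ) : ℂ) • 1, s • gellMann 0, s • gellMann 1],
     ![s • gellMann 2, s • gellMann 3, s • gellMann 4],
     ![s • gellMann 5, s • gellMann 6, s • gellMann 7]] :
    Fin 3 → Fin 3 → Matrix (Fin 3) (Fin 3) ℂ) a.1 a.2

/-- The ket `|i j⟩` of `ℂ³ ⊗ ℂ³`. -/
def ket (i j : Fin 3) : Fin 3 × Fin 3 → ℂ := Pi.single (i, j) 1

/-- `|ψ⟩⟨ψ|` -/
def outer (ψ : Fin 3 × Fin 3 → ℂ) : BipartiteOp 3 := Matrix.vecMulVec ψ (star ψ)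

/-- The family `ρ_β = (1 / (5 + 2 β²)) ∑ |εᵢ⟩⟨εᵢ|` with `|εᵢ⟩ = |0 i⟩ - β |i 0⟩` for `i = 1, 2` and
`|ε₃⟩ = |0 0⟩ + |1 1⟩ + |2 2⟩`. -/
def rhoBeta (β : ℝ) : BipartiteOp 3 :=
  ((1 / (5 + 2 * β ^ 2) : ℝ) : ℂ) •
    (outer (ket 0 1 - (β : ℂ) • ket 1 0) + outer (ket 0 2 - (β : ℂ) • ket 2 0)
      + outer (ket 0 0 + ket 1 1 + ket 2 2))

end

/-! For a separable state all terms of the witness value are controlled. Its correlation matrix is a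
convex combination of `u vᵀ`, where Bessel and the purity bound give `u` and `v` norm at most one.
Hence `‖C‖₁ ≤ 1` and `Re Tr(Cρ) ≤ λ_max`, while `d(d-1)/2 ≥ 1`. The remaining point is `k ≤ 0`
(`det_one_add_sum_vecMulVec_le`): build `ρ` from product projections one at a time; each multiplies
the determinant by `1 + ⟨v, X⁻¹v⟩`, and this factor is at least the corresponding one on the second
tensor factor.

The maximally entangled state violates positivity for every canonical basis: there `k = (1+1/d)^d -
2 ≥ 1/4`, and the term `d²(d+1)²k` outweighs the rest, since `Re Tr(Cρ) ≥ -1`. Its entanglement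
follows from the separable bound itself.

For `ρ_β`, a zero diagonal entry beside a nonzero coherence excludes separability. Cauchy-Schwarz
gives `‖C‖₁ ≤ √9 = 3` for every two-qutrit state. Negativity of the witness reduces, through
explicit values of `k` and `Tr(Cρ)` and the bound `λ_max ≤ 3/(5+2β²)`, to a polynomial inequality on
the interval. -/

/-! ### Hilbert-Schmidt inequalities and spectral preliminaries -/

/-- **Bessel's inequality** for the Hilbert-Schmidt inner product. -/
theorem sum_norm_trace_mul_sq_le {n ι : Type*} [Fintype n] [Fintype ι] [DecidableEq ι]
    {G : ι → Matrix n n ℂ}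
    (hG : ∀ a b, ((G a).conjTranspose * G b).trace = if a = b then 1 else 0) (A : Matrix n n ℂ) :
    ∑ a, ‖(A * G a).trace‖ ^ 2 ≤ ∑ i, ∑ j, ‖A i j‖ ^ 2 := by
  let V : Matrix n n ℂ → EuclideanSpace ℂ (n × n) := fun X => WithLp.toLp 2 fun p => X p.1 p.2
  have hV : ∀ X Y : Matrix n n ℂ, inner ℂ (V X) (V Y) = (X.conjTranspose * Y).trace := by
    intro X Y
    simp only [V, EuclideanSpace.inner_toLp_toLp, dotProduct, Matrix.trace, Matrix.diag,
      Matrix.mul_apply, Matrix.conjTranspose_apply, Fintype.sum_prod_type, Pi.star_apply]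
    rw [Finset.sum_comm]
    exact Finset.sum_congr rfl fun _ _ => Finset.sum_congr rfl fun _ _ => mul_comm _ _
  have hO : Orthonormal ℂ fun a => V (G a) := by
    rw [orthonormal_iff_ite]
    intro a b
    rw [hV, hG]
  have h := hO.sum_inner_products_le (V A.conjTranspose) (s := Finset.univ)
  have h1 : ∀ a, ‖inner ℂ (V (G a)) (V A.conjTranspose)‖ = ‖(A * G a).trace‖ := by
    intro a
    rw [hV, ← Matrix.conjTranspose_mul, Matrix.trace_conjTranspose, norm_star]
  have h2 : ‖V A.conjTranspose‖ ^ 2 = ∑ i, ∑ j, ‖A i j‖ ^ 2 := by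
    rw [EuclideanSpace.norm_sq_eq, Fintype.sum_prod_type, Finset.sum_comm]
    simp [V]
  simpa only [h1, h2] using h

/-- This is nonnegativity of the principal `2 × 2` minor on `i, j`; for `i = j` the minor is zero,
so the repeated index is harmless. -/
theorem Matrix.PosSemidef.norm_apply_sq_le {n : Type*} [Fintype n] {A : Matrix n n ℂ}
    (hA : A.PosSemidef) (i j : n) : ‖A i j‖ ^ 2 ≤ (A i i).re * (A j j).re := by
  have h := (hA.submatrix ![i, j]).det_nonneg
  rw [Matrix.det_fin_two] at h
  have hji : A j i = star (A i j) := (hA.1.apply j i).symm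
  have hi := (Complex.nonneg_iff.1 (hA.diag_nonneg (i := i))).2
  have hj := (Complex.nonneg_iff.1 (hA.diag_nonneg (i := j))).2
  have h' := (Complex.nonneg_iff.1 h).1
  simp only [Matrix.submatrix_apply, Matrix.cons_val_zero, Matrix.cons_val_one, hji] at h'
  rw [← Complex.normSq_eq_norm_sq, Complex.normSq_apply]
  simp [Complex.mul_re, ← hi, ← hj] at h'
  linarith

theorem Matrix.PosSemidef.sum_norm_sq_le {n : Type*} [Fintype n] {A : Matrix n n ℂ}
    (hA : A.PosSemidef) : ∑ i, ∑ j, ‖A i j‖ ^ 2 ≤ A.trace.re ^ 2 := by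
  calc ∑ i, ∑ j, ‖A i j‖ ^ 2 ≤ ∑ i, ∑ j, (A i i).re * (A j j).re :=
        Finset.sum_le_sum fun i _ => Finset.sum_le_sum fun j _ => hA.norm_apply_sq_le i j
    _ = A.trace.re ^ 2 := by
        rw [← Finset.sum_mul_sum, Matrix.trace, Complex.re_sum, sq]
        rfl

theorem IsDensityMatrix.sum_norm_sq_le {n : Type*} [Fintype n] {A : Matrix n n ℂ}
    (hA : IsDensityMatrix A) : ∑ i, ∑ j, ‖A i j‖ ^ 2 ≤ 1 := by
  simpa [hA.2] using hA.1.sum_norm_sq_le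

/-- The spectral decomposition of a Hermitian matrix into rank one projections. -/
theorem Matrix.IsHermitian.eq_sum_vecMulVec {n : Type*} [Fintype n] [DecidableEq n]
    {A : Matrix n n ℂ} (hA : A.IsHermitian) :
    A = ∑ k, (hA.eigenvalues k : ℂ) • Matrix.vecMulVec (⇑(hA.eigenvectorBasis k))
      (star ⇑(hA.eigenvectorBasis k)) := by
  conv_lhs => rw [hA.spectral_theorem, Unitary.conjStarAlgAut_apply]
  ext i j
  rw [Matrix.mul_apply, Matrix.sum_apply]
  refine Finset.sum_congr rfl fun k _ => ?_
  rw [Matrix.mul_diagonal]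
  simp [Matrix.vecMulVec_apply, Matrix.star_apply]
  ring

theorem Matrix.IsHermitian.star_eigenvectorBasis_dotProduct {n : Type*} [Fintype n] [DecidableEq n]
    {A : Matrix n n ℂ} (hA : A.IsHermitian) (k : n) :
    star ⇑(hA.eigenvectorBasis k) ⬝ᵥ ⇑(hA.eigenvectorBasis k) = 1 := by
  rw [dotProduct_comm, ← EuclideanSpace.inner_eq_star_dotProduct]
  simp

theorem star_dotProduct_self_re {n : Type*} [Fintype n] (x : n → ℂ) :
    (star x ⬝ᵥ x).re = ∑ i, ‖x i‖ ^ 2 := by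
  simp [dotProduct, ← Complex.normSq_eq_norm_sq, Complex.normSq_apply]

theorem norm_star_dotProduct_sq_le {n : Type*} [Fintype n] (x y : n → ℂ) :
    ‖star x ⬝ᵥ y‖ ^ 2 ≤ (∑ i, ‖x i‖ ^ 2) * ∑ i, ‖y i‖ ^ 2 := by
  have h := norm_inner_le_norm (𝕜 := ℂ) (WithLp.toLp 2 x : EuclideanSpace ℂ n)
    (WithLp.toLp 2 y : EuclideanSpace ℂ n)
  rw [EuclideanSpace.inner_toLp_toLp, dotProduct_comm] at h
  calc ‖star x ⬝ᵥ y‖ ^ 2 ≤ _ := pow_le_pow_left₀ (norm_nonneg _) h 2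
    _ = _ := by rw [mul_pow, EuclideanSpace.norm_sq_eq, EuclideanSpace.norm_sq_eq]

/-! ### Rayleigh quotient bounds for the largest eigenvalue -/

section lambdaMax

variable {n : Type*} [Fintype n] [DecidableEq n] {A : Matrix n n ℂ}

theorem Matrix.IsHermitian.posSemidef_lambdaMax_smul_one_sub (hA : A.IsHermitian) :
    ((lambdaMax A : ℂ) • (1 : Matrix n n ℂ) - A).PosSemidef := by
  have hH : ((lambdaMax A : ℂ) • (1 : Matrix n n ℂ) - A).IsHermitian := by
    refine Matrix.IsHermitian.sub ?_ hA
    rw [Matrix.IsHermitian, Matrix.conjTranspose_smul, Matrix.conjTranspose_one]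
    simp
  refine Matrix.posSemidef_iff_isHermitian_and_spectrum_nonneg.2 ⟨hH, ?_⟩
  intro z hz
  have e : (lambdaMax A : ℂ) • (1 : Matrix n n ℂ) = algebraMap ℂ _ (lambdaMax A : ℂ) := by
    rw [Algebra.algebraMap_eq_smul_one]
  rw [e, ← spectrum.singleton_sub_eq, Set.singleton_sub, hA.spectrum_eq_image_range] at hz
  obtain ⟨_, ⟨μ, hμ, rfl⟩, rfl⟩ := hz
  have : μ ≤ lambdaMax A := by
    rw [lambdaMax, hA.spectrum_real_eq_range_eigenvalues]
    exact le_csSup (Set.finite_range _).bddAbove hμ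
  simpa using this

theorem Matrix.IsHermitian.re_dotProduct_mulVec_le (hA : A.IsHermitian) (x : n → ℂ) :
    (star x ⬝ᵥ (A.mulVec x)).re ≤ lambdaMax A * ∑ i, ‖x i‖ ^ 2 := by
  have h := hA.posSemidef_lambdaMax_smul_one_sub.dotProduct_mulVec_nonneg x
  rw [Matrix.sub_mulVec, Matrix.smul_mulVec, Matrix.one_mulVec, dotProduct_sub,
    dotProduct_smul] at h
  have h' := (Complex.nonneg_iff.1 h).1
  rw [Complex.sub_re, smul_eq_mul, Complex.re_ofReal_mul, star_dotProduct_self_re] at h'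
  linarith

theorem lambdaMax_le [Nonempty n] (hA : A.IsHermitian) {c : ℝ}
    (h : ∀ x : n → ℂ, (star x ⬝ᵥ (A.mulVec x)).re ≤ c * ∑ i, ‖x i‖ ^ 2) : lambdaMax A ≤ c := by
  rw [lambdaMax, hA.spectrum_real_eq_range_eigenvalues]
  refine csSup_le (Set.range_nonempty _) ?_
  rintro _ ⟨i, rfl⟩
  have h1 := h ⇑(hA.eigenvectorBasis i)
  rw [← star_dotProduct_self_re, hA.star_eigenvectorBasis_dotProduct] at h1
  rw [hA.eigenvalues_eq]
  simpa using h1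

theorem IsDensityMatrix.lambdaMax_pos (hA : IsDensityMatrix A) : 0 < lambdaMax A := by
  by_contra! hle
  have hd : ∀ i, (A i i).re ≤ 0 := fun i => by
    have h := (hA.1.1.posSemidef_lambdaMax_smul_one_sub).diag_nonneg (i := i)
    have h' := (Complex.nonneg_iff.1 h).1
    simp at h'
    linarith
  have h2 : A.trace.re ≤ 0 := by
    rw [Matrix.trace, Complex.re_sum]
    exact Finset.sum_nonpos fun i _ => hd i
  rw [hA.2] at h2
  norm_num at h2

end lambdaMax

/-! ### Trace norm estimates -/

section traceNorm

variable {n : Type*} [Fintype n] [DecidableEq n]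

theorem sum_eigenvalues_conjTranspose_mul_self (A : Matrix n n ℂ) :
    ∑ i, (Matrix.isHermitian_conjTranspose_mul_self A).eigenvalues i = ∑ i, ∑ j, ‖A i j‖ ^ 2 := by
  have h := congrArg Complex.re (Matrix.isHermitian_conjTranspose_mul_self A).trace_eq_sum_eigenvalues
  rw [Complex.re_sum] at h
  simp only [Complex.coe_algebraMap, Complex.ofReal_re] at h
  rw [← h, Matrix.trace, Complex.re_sum, Finset.sum_comm]
  refine Finset.sum_congr rfl fun i _ => ?_
  rw [Matrix.diag_apply, Matrix.mul_apply, Complex.re_sum]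
  refine Finset.sum_congr rfl fun j _ => ?_
  simp [← Complex.normSq_eq_norm_sq, Complex.normSq_apply]

/-- Cauchy-Schwarz over the singular values, whose squares sum to the squared Frobenius norm. -/
theorem traceNorm_sq_le (A : Matrix n n ℂ) :
    traceNorm A ^ 2 ≤ Fintype.card n * ∑ i, ∑ j, ‖A i j‖ ^ 2 := by
  rw [← sum_eigenvalues_conjTranspose_mul_self, traceNorm]
  refine (sq_sum_le_card_mul_sum_sq (s := Finset.univ)).trans_eq ?_
  congr 1
  refine Finset.sum_congr rfl fun i _ => Real.sq_sqrt ?_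
  exact (Matrix.posSemidef_conjTranspose_mul_self A).eigenvalues_nonneg i

/-- The trace norm of a convex combination of rank one matrices `uⱼ vⱼᵀ`, all vectors having norm
at most one, is at most one. -/
theorem traceNorm_sum_smul_vecMulVec_le {ι : Type*} [Fintype ι] {p : ι → ℝ} (hp : ∀ j, 0 ≤ p j)
    {u v : ι → n → ℂ} (hu : ∀ j, ∑ a, ‖u j a‖ ^ 2 ≤ 1) (hv : ∀ j, ∑ a, ‖v j a‖ ^ 2 ≤ 1) :
    traceNorm (∑ j, (p j : ℂ) • Matrix.vecMulVec (u j) (v j)) ≤ ∑ j, p j := by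
  set C := ∑ j, (p j : ℂ) • Matrix.vecMulVec (u j) (v j) with hC
  set H := Matrix.isHermitian_conjTranspose_mul_self C
  let w : n → EuclideanSpace ℂ n := fun i => H.eigenvectorBasis i
  let s : n → ℝ := fun i => √(H.eigenvalues i)
  -- The `w i` are right singular vectors and the `f i` left ones. Since `0⁻¹ = 0`, `f i` vanishes
  -- when `s i = 0`, so Bessel holds for the whole family although only part of it is orthonormal.
  let f : n → EuclideanSpace ℂ n := fun i => ((s i)⁻¹ : ℂ) • WithLp.toLp 2 (C.mulVec (w i))
  have hs : ∀ i, s i ^ 2 = H.eigenvalues i := fun i =>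
    Real.sq_sqrt ((Matrix.posSemidef_conjTranspose_mul_self C).eigenvalues_nonneg i)
  have hCC : ∀ i k, inner ℂ (WithLp.toLp 2 (C.mulVec (w i)) : EuclideanSpace ℂ n)
      (WithLp.toLp 2 (C.mulVec (w k))) = if i = k then (s i : ℂ) ^ 2 else 0 := by
    intro i k
    rw [EuclideanSpace.inner_toLp_toLp, dotProduct_comm, Matrix.star_mulVec,
      ← Matrix.dotProduct_mulVec, Matrix.mulVec_mulVec, H.mulVec_eigenvectorBasis,
      dotProduct_smul, dotProduct_comm, ← EuclideanSpace.inner_eq_star_dotProduct,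
      orthonormal_iff_ite.1 H.eigenvectorBasis.orthonormal, ← Complex.ofReal_pow, hs]
    split_ifs with h
    · subst h; simp
    · simp
  have hin : ∀ i, inner ℂ (f i) (WithLp.toLp 2 (C.mulVec (w i))) = (s i : ℂ) := by
    intro i
    simp only [f]
    rw [inner_smul_left, hCC, if_pos rfl]
    by_cases h : s i = 0
    · simp [h]
    · have : (s i : ℂ) ≠ 0 := by exact_mod_cast h
      simp
      field_simp
  have hf : Orthonormal ℂ fun i : {i // s i ≠ 0} => f i := by
    rw [orthonormal_iff_ite]
    rintro ⟨i, hi⟩ ⟨k, hk⟩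
    simp only [f]
    have : (s i : ℂ) ≠ 0 := by exact_mod_cast hi
    rw [inner_smul_left, inner_smul_right, hCC]
    by_cases h : i = k
    · subst h
      simp
      field_simp
    · simp [h]
  have hf0 : ∀ i, s i = 0 → f i = 0 := fun i h => by simp [f, h]
  have bessel : ∀ x : EuclideanSpace ℂ n, ∑ i, ‖inner ℂ (f i) x‖ ^ 2 ≤ ‖x‖ ^ 2 := by
    intro x
    have := hf.sum_inner_products_le x (s := Finset.univ)
    refine le_trans (le_of_eq ?_) this
    rw [← Finset.sum_subtype (Finset.univ.filter fun i => s i ≠ 0) (by simp)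
      fun i => ‖inner ℂ (f i) x‖ ^ 2]
    refine (Finset.sum_filter_of_ne ?_).symm
    intro i _ h h0
    simp [hf0 i h0] at h
  -- The contribution of one `u vᵀ` to `∑ ⟨f i, C (w i)⟩`: AM-GM splits each product, then Bessel in
  -- `f` and Parseval in `w` bound the two halves.
  have key : ∀ j, ∑ i, (inner ℂ (f i) (WithLp.toLp 2 (u j)) * (v j ⬝ᵥ w i)).re ≤ 1 := by
    intro j
    have h1 : ∀ i, (inner ℂ (f i) (WithLp.toLp 2 (u j)) * (v j ⬝ᵥ w i)).re ≤
        (‖inner ℂ (f i) (WithLp.toLp 2 (u j))‖ ^ 2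
          + ‖inner ℂ (w i) (WithLp.toLp 2 (star (v j)))‖ ^ 2) / 2 := by
      intro i
      -- The row `v` enters unconjugated, so its coordinates in the basis `w` are those of `star v`.
      have e : ‖inner ℂ (w i) (WithLp.toLp 2 (star (v j)))‖ = ‖v j ⬝ᵥ w i‖ := by
        rw [EuclideanSpace.inner_eq_star_dotProduct, ← norm_star, ← Matrix.star_dotProduct_star]
        simp [dotProduct_comm]
      rw [e]
      refine (Complex.re_le_norm _).trans ?_
      rw [norm_mul]
      nlinarith [sq_nonneg (‖inner ℂ (f i) (WithLp.toLp 2 (u j))‖ - ‖v j ⬝ᵥ w i‖)]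
    refine (Finset.sum_le_sum fun i _ => h1 i).trans ?_
    rw [← Finset.sum_div, Finset.sum_add_distrib]
    have h2 := bessel (WithLp.toLp 2 (u j))
    have h3 := H.eigenvectorBasis.sum_sq_norm_inner_right (WithLp.toLp 2 (star (v j)))
    rw [EuclideanSpace.norm_sq_eq] at h2 h3
    simp only [Pi.star_apply, norm_star] at h3
    have h4 := hu j
    have h5 := hv j
    simp only [w]
    linarith
  have hsum : ∀ i, s i = ∑ j, p j * (inner ℂ (f i) (WithLp.toLp 2 (u j)) * (v j ⬝ᵥ w i)).re := by
    intro i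
    have h1 : WithLp.toLp 2 (C.mulVec (w i)) =
        ∑ j, ((p j : ℂ) * (v j ⬝ᵥ w i)) • (WithLp.toLp 2 (u j) : EuclideanSpace ℂ n) := by
      ext a
      simp [hC, Matrix.sum_mulVec, Matrix.smul_mulVec, Matrix.vecMulVec_mulVec]
      refine Finset.sum_congr rfl fun j _ => ?_
      ring
    have h2 := congrArg Complex.re (hin i)
    rw [h1, inner_sum, Complex.re_sum, Complex.ofReal_re] at h2
    rw [← h2]
    refine Finset.sum_congr rfl fun j _ => ?_
    rw [inner_smul_right, ← Complex.re_ofReal_mul]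
    ring_nf
  calc traceNorm C = ∑ i, s i := rfl
    _ = ∑ j, p j * ∑ i, (inner ℂ (f i) (WithLp.toLp 2 (u j)) * (v j ⬝ᵥ w i)).re := by
        simp_rw [Finset.mul_sum]
        rw [Finset.sum_comm]
        exact Finset.sum_congr rfl fun i _ => hsum i
    _ ≤ ∑ j, p j := Finset.sum_le_sum fun j _ => by
        simpa using mul_le_mul_of_nonneg_left (key j) (hp j)

end traceNorm

/-! ### Determinants of separable states and of their marginals -/

section detGap

/-- The matrix determinant lemma; it drives the induction on rank one terms. -/
theorem Matrix.PosDef.det_add_vecMulVec {n : Type*} [Fintype n] [DecidableEq n] {X : Matrix n n ℂ}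
    (hX : X.PosDef) (w : n → ℂ) :
    (X + Matrix.vecMulVec w (star w)).det = X.det * (1 + star w ⬝ᵥ (X⁻¹.mulVec w)) := by
  rw [Matrix.vecMulVec_eq Unit, Matrix.det_add_replicateCol_mul_replicateRow
    ((Matrix.isUnit_iff_isUnit_det _).1 hX.isUnit), Matrix.det_unique (n := Unit),
    Matrix.mul_assoc]
  simp [Matrix.mul_apply, dotProduct, Matrix.mulVec]

/-- The variational lower bound for the quadratic form of the inverse. -/
theorem Matrix.PosDef.two_mul_re_sub_le {n : Type*} [Fintype n] [DecidableEq n] {X : Matrix n n ℂ}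
    (hX : X.PosDef) (y w : n → ℂ) :
    2 * (star y ⬝ᵥ w).re - (star y ⬝ᵥ (X.mulVec y)).re ≤ (star w ⬝ᵥ (X⁻¹.mulVec w)).re := by
  have hu : IsUnit X.det := (Matrix.isUnit_iff_isUnit_det _).1 hX.isUnit
  -- Completing the square: the quadratic form of `X` at `y - X⁻¹ w` is nonnegative.
  have h := (Complex.nonneg_iff.1
    (hX.posSemidef.dotProduct_mulVec_nonneg (y - X⁻¹.mulVec w))).1
  have e : X.mulVec (X⁻¹.mulVec w) = w := by
    rw [Matrix.mulVec_mulVec, Matrix.mul_nonsing_inv _ hu, Matrix.one_mulVec]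
  have e2 : star (X⁻¹.mulVec w) ⬝ᵥ (X.mulVec y) = star w ⬝ᵥ y := by
    rw [Matrix.star_mulVec, ← Matrix.dotProduct_mulVec, Matrix.mulVec_mulVec, hX.inv.1.eq,
      Matrix.nonsing_inv_mul _ hu, Matrix.one_mulVec]
  have e3 : star (X⁻¹.mulVec w) ⬝ᵥ w = star w ⬝ᵥ (X⁻¹.mulVec w) := by
    rw [Matrix.star_mulVec, ← Matrix.dotProduct_mulVec, hX.inv.1.eq]
  have e4 : (star w ⬝ᵥ y).re = (star y ⬝ᵥ w).re := by
    rw [← star_star (star w ⬝ᵥ y), Matrix.star_dotProduct, star_star]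
    simp [dotProduct_comm]
  rw [Matrix.mulVec_sub, e, star_sub, sub_dotProduct, dotProduct_sub, dotProduct_sub, e2, e3] at h
  simp only [Complex.sub_re, e4] at h
  linarith

/-- The product vector `a ⊗ b`. -/
def prodVec {m n : Type*} (a : m → ℂ) (b : n → ℂ) : m × n → ℂ := fun q => a q.1 * b q.2

theorem star_prodVec_dotProduct {m n : Type*} [Fintype m] [Fintype n] (a a' : m → ℂ)
    (b b' : n → ℂ) :
    star (prodVec a b) ⬝ᵥ prodVec a' b' = (star a ⬝ᵥ a') * (star b ⬝ᵥ b') := by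
  simp only [dotProduct, Fintype.sum_prod_type, prodVec, Pi.star_apply, Finset.sum_mul_sum, star_mul']
  exact Finset.sum_congr rfl fun _ _ => Finset.sum_congr rfl fun _ _ => by ring

theorem posSemidef_sum_vecMulVec {n ι : Type*} [Fintype n] (s : Finset ι) (v : ι → n → ℂ) :
    (∑ i ∈ s, Matrix.vecMulVec (v i) (star (v i))).PosSemidef :=
  Matrix.posSemidef_sum s fun i _ => Matrix.posSemidef_vecMulVec_self_star (v i)

theorem posDef_one_add_sum_vecMulVec {n ι : Type*} [Fintype n] [DecidableEq n] (s : Finset ι)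
    (v : ι → n → ℂ) : (1 + ∑ i ∈ s, Matrix.vecMulVec (v i) (star (v i))).PosDef :=
  Matrix.PosDef.one.add_posSemidef (posSemidef_sum_vecMulVec s v)

theorem re_dotProduct_one_add_sum_vecMulVec {n ι : Type*} [Fintype n] [DecidableEq n]
    (s : Finset ι) (v : ι → n → ℂ) (x : n → ℂ) :
    (star x ⬝ᵥ ((1 + ∑ i ∈ s, Matrix.vecMulVec (v i) (star (v i))).mulVec x)).re =
      (star x ⬝ᵥ x).re + ∑ i ∈ s, ‖star (v i) ⬝ᵥ x‖ ^ 2 := by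
  rw [Matrix.add_mulVec, Matrix.one_mulVec, dotProduct_add, Complex.add_re, Matrix.sum_mulVec,
    dotProduct_sum, Complex.re_sum]
  congr 1
  refine Finset.sum_congr rfl fun i _ => ?_
  rw [Matrix.vecMulVec_mulVec, op_smul_eq_smul, dotProduct_smul, smul_eq_mul]
  have : star x ⬝ᵥ v i = star (star (v i) ⬝ᵥ x) := by
    rw [Matrix.star_dotProduct]
  rw [this, Complex.star_def, Complex.mul_conj, Complex.ofReal_re, Complex.normSq_eq_norm_sq]

/-- Sums of product projections are more disordered globally than locally: passing to the second
factor does not increase `det (1 + ·)`. -/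
theorem det_one_add_sum_vecMulVec_le {m n ι : Type*} [Fintype m] [DecidableEq m] [Fintype n]
    [DecidableEq n] (s : Finset ι) {a : ι → m → ℂ} (ha : ∀ i, star (a i) ⬝ᵥ a i = 1)
    (b : ι → n → ℂ) :
    (1 + ∑ i ∈ s, Matrix.vecMulVec (b i) (star (b i))).det ≤
      (1 + ∑ i ∈ s, Matrix.vecMulVec (prodVec (a i) (b i)) (star (prodVec (a i) (b i)))).det := by
  classical
  have norm_a : ∀ i, ∑ k, ‖a i k‖ ^ 2 = 1 := fun i => by
    rw [← star_dotProduct_self_re, ha, Complex.one_re]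
  induction s using Finset.induction_on with
  | empty => simp
  | insert j s hj ih =>
    have hX := posDef_one_add_sum_vecMulVec s fun i => prodVec (a i) (b i)
    have hY := posDef_one_add_sum_vecMulVec s b
    rw [Finset.sum_insert hj, Finset.sum_insert hj, add_comm (Matrix.vecMulVec _ _),
      add_comm (Matrix.vecMulVec _ _), ← add_assoc, ← add_assoc, hX.det_add_vecMulVec,
      hY.det_add_vecMulVec]
    set X := 1 + ∑ i ∈ s, Matrix.vecMulVec (prodVec (a i) (b i)) (star (prodVec (a i) (b i)))
      with hXd
    set Y := 1 + ∑ i ∈ s, Matrix.vecMulVec (b i) (star (b i)) with hYd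
    have hqX := hX.inv.posSemidef.dotProduct_mulVec_nonneg (prodVec (a j) (b j))
    have hqY := hY.inv.posSemidef.dotProduct_mulVec_nonneg (b j)
    have hle : star (b j) ⬝ᵥ (Y⁻¹.mulVec (b j)) ≤
        star (prodVec (a j) (b j)) ⬝ᵥ (X⁻¹.mulVec (prodVec (a j) (b j))) := by
      have hre : (star (b j) ⬝ᵥ (Y⁻¹.mulVec (b j))).re ≤
          (star (prodVec (a j) (b j)) ⬝ᵥ (X⁻¹.mulVec (prodVec (a j) (b j)))).re := by
        set z := Y⁻¹.mulVec (b j) with hz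
        have hYz : Y.mulVec z = b j := by
          rw [hz, Matrix.mulVec_mulVec,
            Matrix.mul_nonsing_inv _ ((Matrix.isUnit_iff_isUnit_det _).1 hY.isUnit),
            Matrix.one_mulVec]
        have hzb : star z ⬝ᵥ b j = star (b j) ⬝ᵥ z := by
          rw [hz, Matrix.star_mulVec, ← Matrix.dotProduct_mulVec, hY.inv.1.eq]
        -- The trial vector `a j ⊗ z` with `z = Y⁻¹ b j` is optimal for `Y`. Replacing `Y` by `X`
        -- can only lower the quadratic form, because each overlap `|⟨a i, a j⟩|` is at most one.
        have h1 := hX.two_mul_re_sub_le (prodVec (a j) z) (prodVec (a j) (b j))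
        have h2 : (star (prodVec (a j) z) ⬝ᵥ (X.mulVec (prodVec (a j) z))).re ≤
            (star z ⬝ᵥ (Y.mulVec z)).re := by
          rw [hXd, re_dotProduct_one_add_sum_vecMulVec, hYd, re_dotProduct_one_add_sum_vecMulVec,
            star_prodVec_dotProduct, ha, one_mul]
          refine add_le_add_right (Finset.sum_le_sum fun i _ => ?_) _
          rw [star_prodVec_dotProduct, norm_mul, mul_pow]
          have h3 := norm_star_dotProduct_sq_le (a i) (a j)
          rw [norm_a, norm_a, mul_one] at h3
          exact mul_le_of_le_one_left (sq_nonneg _) h3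
        rw [star_prodVec_dotProduct, ha, one_mul, hzb] at h1
        rw [hYz, hzb] at h2
        linarith
      -- The order on `ℂ` also demands equal imaginary parts; both vanish, as the two forms are
      -- nonnegative.
      exact Complex.le_def.2 ⟨hre, by
        rw [← (Complex.nonneg_iff.1 hqX).2, ← (Complex.nonneg_iff.1 hqY).2]⟩
    have h0 : 0 ≤ Y.det := hY.det_pos.le
    have h1 : 0 ≤ 1 + star (b j) ⬝ᵥ (Y⁻¹.mulVec (b j)) := add_nonneg zero_le_one hqY
    exact mul_le_mul ih (by gcongr) h1 (h0.trans ih)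

end detGap

theorem partialTraceA_sum {d : ℕ} {ι : Type*} (s : Finset ι) (f : ι → BipartiteOp d) :
    partialTraceA (∑ i ∈ s, f i) = ∑ i ∈ s, partialTraceA (f i) := by
  ext j l
  simp only [partialTraceA, Matrix.of_apply, Matrix.sum_apply]
  exact Finset.sum_comm

theorem partialTraceA_vecMulVec_prodVec {d : ℕ} {a : Fin d → ℂ} (ha : star a ⬝ᵥ a = 1)
    (b : Fin d → ℂ) :
    partialTraceA (Matrix.vecMulVec (prodVec a b) (star (prodVec a b))) =
      Matrix.vecMulVec b (star b) := by
  ext j l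
  have h : ∑ i, star (a i) * a i = 1 := ha
  simp only [partialTraceA, Matrix.of_apply, Matrix.vecMulVec_apply, prodVec, Pi.star_apply, star_mul']
  calc ∑ i, a i * b j * (star (a i) * star (b l)) = (∑ i, star (a i) * a i) * (b j * star (b l)) := by
        rw [Finset.sum_mul]
        exact Finset.sum_congr rfl fun _ _ => by ring
    _ = _ := by rw [h, one_mul]

/-- A separable state is a sum of projections onto product vectors. -/
theorem IsSeparableState.exists_eq_sum_vecMulVec {d : ℕ} {ρ : BipartiteOp d}
    (h : IsSeparableState ρ) :
    ∃ (m : ℕ) (a b : Fin m × Fin d × Fin d → Fin d → ℂ), (∀ i, star (a i) ⬝ᵥ a i = 1) ∧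
      ρ = ∑ i, Matrix.vecMulVec (prodVec (a i) (b i)) (star (prodVec (a i) (b i))) := by
  obtain ⟨m, p, A, B, hp, -, hA, hB, rfl⟩ := h
  refine ⟨m, fun i => (hA i.1).1.1.eigenvectorBasis i.2.1,
    -- All weights go into `b`, so that `a` stays a unit vector and tracing out the first factor
    -- just deletes it.
    fun i => ((√(p i.1 * (hA i.1).1.1.eigenvalues i.2.1 * (hB i.1).1.1.eigenvalues i.2.2) : ℝ) : ℂ) •
      ⇑((hB i.1).1.1.eigenvectorBasis i.2.2),
    fun i => (hA i.1).1.1.star_eigenvectorBasis_dotProduct i.2.1, ?_⟩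
  rw [Fintype.sum_prod_type]
  refine Finset.sum_congr rfl fun j _ => ?_
  rw [Fintype.sum_prod_type]
  ext q r
  conv_lhs => rw [(hA j).1.1.eq_sum_vecMulVec, (hB j).1.1.eq_sum_vecMulVec]
  simp only [Matrix.smul_apply, Matrix.kroneckerMap_apply, Matrix.sum_apply, smul_eq_mul]
  rw [Finset.sum_mul_sum, Finset.mul_sum]
  refine Finset.sum_congr rfl fun k _ => ?_
  rw [Finset.mul_sum]
  refine Finset.sum_congr rfl fun l _ => ?_
  have h0 : 0 ≤ p j * (hA j).1.1.eigenvalues k * (hB j).1.1.eigenvalues l :=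
    mul_nonneg (mul_nonneg (hp j) ((hA j).1.eigenvalues_nonneg k)) ((hB j).1.eigenvalues_nonneg l)
  have h1 : ((√(p j * (hA j).1.1.eigenvalues k * (hB j).1.1.eigenvalues l) : ℝ) : ℂ) ^ 2 =
      p j * (hA j).1.1.eigenvalues k * (hB j).1.1.eigenvalues l := by
    rw [← Complex.ofReal_pow, Real.sq_sqrt h0]
    push_cast
    rfl
  simp only [Matrix.vecMulVec_apply, prodVec, Pi.star_apply, Pi.smul_apply, smul_eq_mul, star_mul',
    Complex.star_def, Complex.conj_ofReal]
  generalize (hA j).1.1.eigenvectorBasis k = u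
  generalize (hB j).1.1.eigenvectorBasis l = v
  linear_combination (-(u q.1 * v q.2 * (starRingEnd ℂ (u r.1) * starRingEnd ℂ (v r.2)))) * h1

theorem IsSeparableState.detGap_nonpos {d : ℕ} {ρ : BipartiteOp d} (h : IsSeparableState ρ) :
    detGap ρ ≤ 0 := by
  obtain ⟨m, a, b, ha, rfl⟩ := h.exists_eq_sum_vecMulVec
  rw [detGap, partialTraceA_sum]
  simp only [partialTraceA_vecMulVec_prodVec (ha _)]
  exact sub_nonpos.2 (det_one_add_sum_vecMulVec_le _ ha b)

theorem IsSeparableState.isDensityMatrix {d : ℕ} {ρ : BipartiteOp d} (h : IsSeparableState ρ) :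
    IsDensityMatrix ρ := by
  obtain ⟨m, p, A, B, hp, hp1, hA, hB, rfl⟩ := h
  refine ⟨Matrix.posSemidef_sum _ fun j _ => ?_, ?_⟩
  · exact ((hA j).1.kronecker (hB j).1).smul (Complex.zero_le_real.2 (hp j))
  · simp only [Matrix.trace_sum, Matrix.trace_smul, Matrix.trace_kronecker, (hA _).2, (hB _).2]
    simp only [mul_one, smul_eq_mul]
    exact_mod_cast hp1

/-! ### The correlation matrix and the witness on separable states -/

section correlationMatrix

variable {d : ℕ} {GA GB : Fin d × Fin d → Matrix (Fin d) (Fin d) ℂ}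

theorem correlationMatrix_sum_smul_kronecker {m : ℕ} (p : Fin m → ℂ)
    (A B : Fin m → Matrix (Fin d) (Fin d) ℂ) :
    correlationMatrix GA GB (∑ j, p j • (A j ⊗ₖ B j)) =
      ∑ j, p j • Matrix.vecMulVec (fun a => (A j * GA a).trace) (fun b => (B j * GB b).trace) := by
  ext a b
  simp [correlationMatrix, Matrix.sum_apply, Finset.sum_mul, Matrix.trace_sum,
    ← Matrix.mul_kronecker_mul, Matrix.trace_kronecker, Matrix.vecMulVec_apply]

/-- The products `GA a ⊗ GB b` are again orthonormal, so Bessel applies on the bipartite space. -/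
theorem sum_norm_correlationMatrix_sq_le (hA : IsCanonicalBasis GA) (hB : IsCanonicalBasis GB)
    (ρ : BipartiteOp d) :
    ∑ a, ∑ b, ‖correlationMatrix GA GB ρ a b‖ ^ 2 ≤ ∑ q, ∑ r, ‖ρ q r‖ ^ 2 := by
  have h := sum_norm_trace_mul_sq_le (n := Fin d × Fin d)
    (G := fun c : (Fin d × Fin d) × (Fin d × Fin d) => GA c.1 ⊗ₖ GB c.2) (fun a b => by
      rw [Matrix.conjTranspose_kronecker, ← Matrix.mul_kronecker_mul, Matrix.trace_kronecker,
        hA.orthonormal, hB.orthonormal]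
      by_cases h1 : a.1 = b.1 <;> by_cases h2 : a.2 = b.2 <;> simp [Prod.ext_iff, h1, h2]) ρ
  rw [Fintype.sum_prod_type] at h
  exact h

theorem witnessValue_eq {ρ : BipartiteOp d} (hρ : IsDensityMatrix ρ) :
    witnessValue GA GB ρ = (dvBound d : ℂ) - (d : ℂ) ^ 2 * ((d : ℂ) + 1) ^ 2 * detGap ρ
      - ((1 / lambdaMax ρ : ℝ) : ℂ) * (correlationMatrix GA GB ρ * ρ).trace := by
  rw [witnessValue, witnessDV, Matrix.sub_mul, Matrix.trace_sub, Matrix.smul_mul, Matrix.one_mul,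
    Matrix.smul_mul, Matrix.trace_smul, Matrix.trace_smul, hρ.2, smul_eq_mul, smul_eq_mul, mul_one]

theorem witnessValue_re {ρ : BipartiteOp d} (hρ : IsDensityMatrix ρ) :
    (witnessValue GA GB ρ).re = dvBound d - (d : ℝ) ^ 2 * ((d : ℝ) + 1) ^ 2 * (detGap ρ).re
      - 1 / lambdaMax ρ * (correlationMatrix GA GB ρ * ρ).trace.re := by
  have h : (d : ℂ) ^ 2 * ((d : ℂ) + 1) ^ 2 = (((d : ℝ) ^ 2 * ((d : ℝ) + 1) ^ 2 : ℝ) : ℂ) := by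
    push_cast
    rfl
  rw [witnessValue_eq hρ, h, Complex.sub_re, Complex.sub_re, Complex.re_ofReal_mul,
    Complex.re_ofReal_mul, Complex.ofReal_re]

theorem one_le_dvBound (hd : 2 ≤ d) : 1 ≤ dvBound d := by
  have : (2 : ℝ) ≤ d := by exact_mod_cast hd
  rw [dvBound]
  nlinarith

/-- Positivity at `x - y` bounds twice the mixed term by the two diagonal ones, each at most
`λ_max`. -/
theorem Matrix.PosSemidef.re_dotProduct_mulVec_le {n : Type*} [Fintype n] [DecidableEq n]
    {ρ : Matrix n n ℂ} (hρ : ρ.PosSemidef) {x y : n → ℂ} (hx : ∑ i, ‖x i‖ ^ 2 ≤ 1)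
    (hy : ∑ i, ‖y i‖ ^ 2 ≤ 1) (h0 : 0 ≤ lambdaMax ρ) :
    (star x ⬝ᵥ (ρ.mulVec y)).re ≤ lambdaMax ρ := by
  have h := (Complex.nonneg_iff.1 (hρ.dotProduct_mulVec_nonneg (x - y))).1
  have hs : star y ⬝ᵥ (ρ.mulVec x) = star (star x ⬝ᵥ (ρ.mulVec y)) := by
    rw [Matrix.star_dotProduct, Matrix.star_mulVec, ← Matrix.dotProduct_mulVec, hρ.1.eq]
  rw [Matrix.mulVec_sub, star_sub, sub_dotProduct, dotProduct_sub, dotProduct_sub, hs] at h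
  simp only [Complex.sub_re, Complex.star_def, Complex.conj_re] at h
  have h1 := hρ.1.re_dotProduct_mulVec_le x
  have h2 := hρ.1.re_dotProduct_mulVec_le y
  have h3 := mul_le_mul_of_nonneg_left hx h0
  have h4 := mul_le_mul_of_nonneg_left hy h0
  linarith

theorem IsDensityMatrix.sum_norm_trace_mul_sq_le (hG : IsCanonicalBasis GA)
    {A : Matrix (Fin d) (Fin d) ℂ} (hA : IsDensityMatrix A) :
    ∑ a, ‖(A * GA a).trace‖ ^ 2 ≤ 1 :=
  (_root_.sum_norm_trace_mul_sq_le hG.orthonormal A).trans hA.sum_norm_sq_le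

theorem IsSeparableState.traceNorm_correlationMatrix_le (hA : IsCanonicalBasis GA)
    (hB : IsCanonicalBasis GB) {ρ : BipartiteOp d} (h : IsSeparableState ρ) :
    traceNorm (correlationMatrix GA GB ρ) ≤ 1 := by
  obtain ⟨m, p, A, B, hp, hp1, hA', hB', rfl⟩ := h
  rw [correlationMatrix_sum_smul_kronecker, ← hp1]
  exact traceNorm_sum_smul_vecMulVec_le hp (fun j => (hA' j).sum_norm_trace_mul_sq_le hA)
    fun j => (hB' j).sum_norm_trace_mul_sq_le hB

/-- Each product term contributes `Tr(u vᵀ ρ) = vᵀ ρ u`, a matrix element of `ρ` between vectors of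
norm at most one. This is what the factor `1/λ_max` in the witness compensates. -/
theorem IsSeparableState.re_trace_correlationMatrix_mul_le (hA : IsCanonicalBasis GA)
    (hB : IsCanonicalBasis GB) {ρ : BipartiteOp d} (h : IsSeparableState ρ) :
    (correlationMatrix GA GB ρ * ρ).trace.re ≤ lambdaMax ρ := by
  have hρ := h.isDensityMatrix
  obtain ⟨m, p, A, B, hp, hp1, hA', hB', h⟩ := h
  have e : correlationMatrix GA GB ρ = ∑ j, (p j : ℂ) •
      Matrix.vecMulVec (fun a => (A j * GA a).trace) (fun b => (B j * GB b).trace) := by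
    rw [h, correlationMatrix_sum_smul_kronecker]
  rw [e, Finset.sum_mul, Matrix.trace_sum, Complex.re_sum]
  calc _ ≤ ∑ j, p j * lambdaMax ρ := Finset.sum_le_sum fun j _ => by
        rw [Matrix.smul_mul, Matrix.trace_smul, smul_eq_mul, Complex.re_ofReal_mul,
          Matrix.vecMulVec_mul, Matrix.trace_vecMulVec, dotProduct_comm, ← Matrix.dotProduct_mulVec]
        refine mul_le_mul_of_nonneg_left ?_ (hp j)
        have := hρ.1.re_dotProduct_mulVec_le (x := star fun b => (B j * GB b).trace)
          (y := fun a => (A j * GA a).trace)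
          (by simpa using (hB' j).sum_norm_trace_mul_sq_le hB)
          ((hA' j).sum_norm_trace_mul_sq_le hA) hρ.lambdaMax_pos.le
        rwa [star_star] at this
    _ = lambdaMax ρ := by rw [← Finset.sum_mul, hp1, one_mul]

theorem IsSeparableState.witnessValue_re_nonneg (hd : 2 ≤ d) (hA : IsCanonicalBasis GA)
    (hB : IsCanonicalBasis GB) {ρ : BipartiteOp d} (h : IsSeparableState ρ) :
    0 ≤ (witnessValue GA GB ρ).re := by
  have hρ := h.isDensityMatrix
  rw [witnessValue_re hρ]
  have h1 := one_le_dvBound hd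
  have h2 : (detGap ρ).re ≤ 0 := (Complex.le_def.1 h.detGap_nonpos).1
  have h3 : 1 / lambdaMax ρ * (correlationMatrix GA GB ρ * ρ).trace.re ≤ 1 := by
    rw [one_div, inv_mul_le_one₀ hρ.lambdaMax_pos]
    exact h.re_trace_correlationMatrix_mul_le hA hB
  have h4 : (d : ℝ) ^ 2 * ((d : ℝ) + 1) ^ 2 * (detGap ρ).re ≤ 0 :=
    mul_nonpos_of_nonneg_of_nonpos (by positivity) h2
  linarith

theorem star_correlationMatrix_apply (hA : ∀ a, (GA a).IsHermitian) (hB : ∀ a, (GB a).IsHermitian)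
    {ρ : BipartiteOp d} (hρ : ρ.IsHermitian) (a b : Fin d × Fin d) :
    star (correlationMatrix GA GB ρ a b) = correlationMatrix GA GB ρ a b := by
  simp only [correlationMatrix, Matrix.of_apply]
  rw [← Matrix.trace_conjTranspose, Matrix.conjTranspose_mul, Matrix.conjTranspose_kronecker,
    hρ.eq, (hA a).eq, (hB b).eq, Matrix.trace_mul_comm]

theorem Matrix.IsHermitian.det_im {n : Type*} [Fintype n] [DecidableEq n] {A : Matrix n n ℂ}
    (hA : A.IsHermitian) : A.det.im = 0 := by
  rw [← Complex.conj_eq_iff_im, ← Complex.star_def, ← Matrix.det_conjTranspose, hA.eq]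

theorem Matrix.IsHermitian.partialTraceA {ρ : BipartiteOp d} (hρ : ρ.IsHermitian) :
    (partialTraceA ρ).IsHermitian := by
  ext j l
  simp only [_root_.partialTraceA, Matrix.conjTranspose_apply, Matrix.of_apply, star_sum]
  exact Finset.sum_congr rfl fun i _ => hρ.apply _ _

theorem detGap_im {ρ : BipartiteOp d} (hρ : ρ.IsHermitian) : (detGap ρ).im = 0 := by
  rw [detGap, Complex.sub_im, (Matrix.isHermitian_one.add hρ.partialTraceA).det_im,
    (Matrix.isHermitian_one.add hρ).det_im, sub_zero]

/-- Hermitian bases make `C` real but not symmetric, so reality of `Tr(Cρ)` is obtained from real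
entries of `ρ`. -/
theorem witnessValue_im (hA : ∀ a, (GA a).IsHermitian) (hB : ∀ a, (GB a).IsHermitian)
    {ρ : BipartiteOp d} (hρ : IsDensityMatrix ρ) (hreal : ∀ q r, star (ρ q r) = ρ q r) :
    (witnessValue GA GB ρ).im = 0 := by
  have h1 : (correlationMatrix GA GB ρ * ρ).trace.im = 0 := by
    rw [← Complex.conj_eq_iff_im, ← Complex.star_def, Matrix.trace, star_sum]
    simp only [Matrix.diag_apply, Matrix.mul_apply, star_sum, star_mul', hreal,
      star_correlationMatrix_apply hA hB hρ.1.1]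
  have h : (d : ℂ) ^ 2 * ((d : ℂ) + 1) ^ 2 = (((d : ℝ) ^ 2 * ((d : ℝ) + 1) ^ 2 : ℝ) : ℂ) := by
    push_cast
    rfl
  rw [witnessValue_eq hρ, h, Complex.sub_im, Complex.sub_im, Complex.im_ofReal_mul,
    Complex.im_ofReal_mul, Complex.ofReal_im, h1, detGap_im hρ.1.1]
  ring

/-- By AM-GM, `|Tr(Cρ)|` is at most the mean of the squared Frobenius norms of `C` and `ρ`, both at
most one. -/
theorem neg_one_le_re_trace_correlationMatrix_mul (hA : IsCanonicalBasis GA) (hB : IsCanonicalBasis GB)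
    {ρ : BipartiteOp d} (hρ : IsDensityMatrix ρ) :
    -1 ≤ (correlationMatrix GA GB ρ * ρ).trace.re := by
  have h1 : -(correlationMatrix GA GB ρ * ρ).trace.re ≤
      ∑ a, ∑ b, (‖correlationMatrix GA GB ρ a b‖ ^ 2 + ‖ρ b a‖ ^ 2) / 2 := by
    rw [Matrix.trace, Complex.re_sum, ← Finset.sum_neg_distrib]
    refine Finset.sum_le_sum fun a _ => ?_
    rw [Matrix.diag_apply, Matrix.mul_apply, Complex.re_sum, ← Finset.sum_neg_distrib]
    refine Finset.sum_le_sum fun b _ => ?_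
    have h := (neg_le_abs _).trans (Complex.abs_re_le_norm (correlationMatrix GA GB ρ a b * ρ b a))
    rw [norm_mul] at h
    nlinarith [sq_nonneg (‖correlationMatrix GA GB ρ a b‖ - ‖ρ b a‖)]
  simp only [← Finset.sum_div, Finset.sum_add_distrib] at h1
  rw [Finset.sum_comm (f := fun a b => ‖ρ b a‖ ^ 2)] at h1
  have h2 := sum_norm_correlationMatrix_sq_le hA hB ρ
  have h3 := hρ.sum_norm_sq_le
  linarith

end correlationMatrix

/-! ### The maximally entangled state violates the witness -/

section maxEntangled

/-- The unnormalized maximally entangled vector `∑ᵢ |i i⟩`. -/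
noncomputable def diagVec (d : ℕ) : Fin d × Fin d → ℂ := fun q => if q.1 = q.2 then 1 else 0

/-- The maximally entangled state. -/
noncomputable def maxEntangled (d : ℕ) : BipartiteOp d :=
  ((1 / d : ℝ) : ℂ) • Matrix.vecMulVec (diagVec d) (star (diagVec d))

variable {d : ℕ}

theorem star_diagVec : star (diagVec d) = diagVec d := by
  ext q
  simp only [diagVec, Pi.star_apply]
  split_ifs <;> simp

theorem diagVec_dotProduct_diagVec : diagVec d ⬝ᵥ diagVec d = d := by
  simp [dotProduct, diagVec, Fintype.sum_prod_type]

theorem isDensityMatrix_maxEntangled (hd : 2 ≤ d) : IsDensityMatrix (maxEntangled d) := by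
  have h : (d : ℂ) ≠ 0 := by exact_mod_cast (by omega : d ≠ 0)
  refine ⟨(Matrix.posSemidef_vecMulVec_self_star _).smul (Complex.zero_le_real.2 (by positivity)), ?_⟩
  rw [maxEntangled, Matrix.trace_smul, Matrix.trace_vecMulVec, star_diagVec,
    diagVec_dotProduct_diagVec]
  simp [h]

/-- The marginal is `I/d`, whereas the state is a rank one projection. -/
theorem detGap_maxEntangled (hd : 2 ≤ d) : detGap (maxEntangled d) = (1 + 1 / (d : ℂ)) ^ d - 2 := by
  have h : (d : ℂ) ≠ 0 := by exact_mod_cast (by omega : d ≠ 0)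
  have h1 : 1 + partialTraceA (maxEntangled d) = (1 + 1 / (d : ℂ)) • 1 := by
    ext j l
    simp [partialTraceA, maxEntangled, Matrix.vecMulVec_apply, star_diagVec, diagVec,
      Matrix.one_apply, eq_comm]
    split_ifs <;> simp
  have h2 : (1 + maxEntangled d).det = 2 := by
    rw [maxEntangled, ← Matrix.smul_vecMulVec, Matrix.vecMulVec_eq Unit,
      Matrix.det_one_add_replicateCol_mul_replicateRow, star_diagVec, dotProduct_smul,
      diagVec_dotProduct_diagVec]
    simp [h]
    norm_num
  rw [detGap, h1, h2, Matrix.det_smul, Matrix.det_one]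
  simp

theorem one_le_lambdaMax_maxEntangled (hd : 2 ≤ d) : 1 ≤ lambdaMax (maxEntangled d) := by
  have h0 : (0 : ℝ) < d := by exact_mod_cast (by omega : 0 < d)
  have h1 : (d : ℂ) ≠ 0 := by exact_mod_cast (by omega : d ≠ 0)
  have h := (isDensityMatrix_maxEntangled hd).1.1.re_dotProduct_mulVec_le (diagVec d)
  have hv : (maxEntangled d).mulVec (diagVec d) = diagVec d := by
    rw [maxEntangled, Matrix.smul_mulVec, Matrix.vecMulVec_mulVec, star_diagVec,
      diagVec_dotProduct_diagVec, op_smul_eq_smul, smul_smul]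
    simp [h1]
  rw [← star_dotProduct_self_re, hv, star_diagVec, diagVec_dotProduct_diagVec,
    Complex.natCast_re] at h
  nlinarith

theorem witnessValue_maxEntangled_re_neg (hd : 2 ≤ d)
    {GA GB : Fin d × Fin d → Matrix (Fin d) (Fin d) ℂ} (hA : IsCanonicalBasis GA)
    (hB : IsCanonicalBasis GB) : (witnessValue GA GB (maxEntangled d)).re < 0 := by
  have hρ := isDensityMatrix_maxEntangled hd
  have h2 : (2 : ℝ) ≤ d := by exact_mod_cast hd
  have hk : 1 / 4 ≤ (detGap (maxEntangled d)).re := by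
    have e : detGap (maxEntangled d) = (((1 + 1 / (d : ℝ)) ^ d - 2 : ℝ) : ℂ) := by
      rw [detGap_maxEntangled hd]
      push_cast
      rfl
    rw [e, Complex.ofReal_re]
    -- Three binomial terms give `(1+1/d)^d ≥ 5/2 - 1/(2d) ≥ 9/4`, which is where `1/4` comes from.
    have hb : ∑ i ∈ Finset.range 3, (1 / (d : ℝ)) ^ i * (d.choose i) ≤ (1 / (d : ℝ) + 1) ^ d := by
      rw [add_pow]
      simp only [one_pow, mul_one]
      refine Finset.sum_le_sum_of_subset_of_nonneg ?_ fun i _ _ => by positivity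
      exact Finset.range_subset_range.2 (by omega)
    rw [Finset.sum_range_succ, Finset.sum_range_succ, Finset.sum_range_one, Nat.cast_choose_two] at hb
    have e1 : (1 / (d : ℝ)) ^ 0 * (d.choose 0) + (1 / (d : ℝ)) ^ 1 * (d.choose 1)
        + (1 / (d : ℝ)) ^ 2 * (d * (d - 1) / 2) = 5 / 2 - 1 / 2 * (1 / d) := by
      simp
      field_simp
      ring
    have e2 : 1 / (d : ℝ) ≤ 1 / 2 := one_div_le_one_div_of_le (by norm_num) h2
    rw [e1, add_comm (1 / (d : ℝ))] at hb
    linarith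
  rw [witnessValue_re hρ]
  have h3 := neg_one_le_re_trace_correlationMatrix_mul hA hB hρ
  have h4 := one_le_lambdaMax_maxEntangled hd
  have h5 : -1 ≤ 1 / lambdaMax (maxEntangled d) *
      (correlationMatrix GA GB (maxEntangled d) * maxEntangled d).trace.re := by
    have h6 : 1 / lambdaMax (maxEntangled d) ≤ 1 := by
      rw [one_div]
      exact inv_le_one_of_one_le₀ h4
    have h7 : 0 < 1 / lambdaMax (maxEntangled d) := by positivity
    nlinarith
  have h8 : (d : ℝ) ^ 2 * ((d : ℝ) + 1) ^ 2 * (1 / 4) ≤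
      (d : ℝ) ^ 2 * ((d : ℝ) + 1) ^ 2 * (detGap (maxEntangled d)).re :=
    mul_le_mul_of_nonneg_left hk (by positivity)
  -- With `(d+1)² ≥ 9` the value is at most `d(d-1)/2 - 9d²/4 + 1`, which is negative.
  have h9 : (9 : ℝ) ≤ ((d : ℝ) + 1) ^ 2 := by nlinarith
  have h10 : (d : ℝ) ^ 2 * 9 ≤ (d : ℝ) ^ 2 * ((d : ℝ) + 1) ^ 2 :=
    mul_le_mul_of_nonneg_left h9 (by positivity)
  rw [dvBound]
  nlinarith

theorem isEntangledState_maxEntangled (hd : 2 ≤ d)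
    {GA GB : Fin d × Fin d → Matrix (Fin d) (Fin d) ℂ} (hA : IsCanonicalBasis GA)
    (hB : IsCanonicalBasis GB) : IsEntangledState (maxEntangled d) :=
  ⟨isDensityMatrix_maxEntangled hd, fun h => (h.witnessValue_re_nonneg hd hA hB).not_gt
    (witnessValue_maxEntangled_re_neg hd hA hB)⟩

theorem star_maxEntangled_apply (q r : Fin d × Fin d) :
    star (maxEntangled d q r) = maxEntangled d q r := by
  rw [maxEntangled, star_diagVec, Matrix.smul_apply, Matrix.vecMulVec_apply, smul_eq_mul]
  simp only [diagVec]
  split_ifs <;> simp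

/-- The state is invariant under exchange of the factors, so with equal bases `C` is symmetric;
being real as well, it is Hermitian. -/
theorem isHermitian_witnessDV_maxEntangled (hd : 2 ≤ d)
    {G : Fin d × Fin d → Matrix (Fin d) (Fin d) ℂ} (hG : ∀ a, (G a).IsHermitian) :
    (witnessDV G G (maxEntangled d)).IsHermitian := by
  have hρ := isDensityMatrix_maxEntangled hd
  have hswap : ∀ q r, maxEntangled d (Prod.swap q) (Prod.swap r) = maxEntangled d q r := by
    intro q r
    simp [maxEntangled, star_diagVec, Matrix.vecMulVec_apply, diagVec, eq_comm]
  have hC : (correlationMatrix G G (maxEntangled d)).IsHermitian := by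
    ext a b
    rw [Matrix.conjTranspose_apply, star_correlationMatrix_apply hG hG hρ.1.1]
    simp only [correlationMatrix, Matrix.of_apply, Matrix.trace, Matrix.diag_apply,
      Matrix.mul_apply]
    rw [← Equiv.sum_comp (Equiv.prodComm (Fin d) (Fin d))]
    refine Finset.sum_congr rfl fun q _ => ?_
    rw [← Equiv.sum_comp (Equiv.prodComm (Fin d) (Fin d))]
    refine Finset.sum_congr rfl fun r _ => ?_
    simp only [Equiv.prodComm_apply, hswap, Matrix.kroneckerMap_apply, Prod.fst_swap, Prod.snd_swap]
    ring
  have hk := Complex.conj_eq_iff_im.2 (detGap_im hρ.1.1)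
  rw [witnessDV]
  refine Matrix.IsHermitian.sub ?_ ?_
  · rw [Matrix.IsHermitian, Matrix.conjTranspose_smul, Matrix.conjTranspose_one]
    simp [hk]
  · rw [Matrix.IsHermitian, Matrix.conjTranspose_smul, hC.eq]
    simp

end maxEntangled

/-! ### The Gell-Mann basis is canonical and Hermitian -/

section gellMann

theorem ofReal_sqrt_two_inv_mul_self : ((√2 : ℝ) : ℂ)⁻¹ * ((√2 : ℝ) : ℂ)⁻¹ = 1 / 2 := by
  rw [← mul_inv, ← Complex.ofReal_mul, Real.mul_self_sqrt (by norm_num)]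
  norm_num

theorem ofReal_sqrt_three_inv_mul_self : ((√3 : ℝ) : ℂ)⁻¹ * ((√3 : ℝ) : ℂ)⁻¹ = 1 / 3 := by
  rw [← mul_inv, ← Complex.ofReal_mul, Real.mul_self_sqrt (by norm_num)]
  norm_num

theorem isHermitian_gellMannBasis (a : Fin 3 × Fin 3) : (gellMannBasis a).IsHermitian := by
  obtain ⟨i, j⟩ := a
  ext k l
  fin_cases i <;> fin_cases j <;> fin_cases k <;> fin_cases l <;>
    simp [gellMannBasis, gellMann]

theorem isCanonicalBasis_gellMannBasis : IsCanonicalBasis gellMannBasis where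
  orthonormal := by
    intro a b
    rw [(isHermitian_gellMannBasis a).eq]
    obtain ⟨i, j⟩ := a
    obtain ⟨k, l⟩ := b
    have h2 := ofReal_sqrt_two_inv_mul_self
    have h3 := ofReal_sqrt_three_inv_mul_self
    have hI := Complex.I_mul_I
    fin_cases i <;> fin_cases j <;> fin_cases k <;> fin_cases l <;>
      simp [gellMannBasis, gellMann, Matrix.trace, Fin.sum_univ_three] <;>
      grind
  first := by
    rintro ⟨i, j⟩ hi hj
    obtain rfl : i = 0 := Fin.ext hi
    obtain rfl : j = 0 := Fin.ext hj
    simp [gellMannBasis]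
  traceless := by
    rintro ⟨i, j⟩ h
    fin_cases i <;> fin_cases j <;> simp at h <;>
      simp [gellMannBasis, gellMann, Matrix.trace, Fin.sum_univ_three]
    ring

end gellMann

/-! ### The family `ρ_β` -/

section rhoBeta

theorem trace_rhoBeta_mul (β : ℝ) (M : BipartiteOp 3) :
    (rhoBeta β * M).trace = ((1 / (5 + 2 * β ^ 2) : ℝ) : ℂ) *
      ((M (0, 1) (0, 1) - β * M (0, 1) (1, 0) - β * M (1, 0) (0, 1) + β ^ 2 * M (1, 0) (1, 0))
      + (M (0, 2) (0, 2) - β * M (0, 2) (2, 0) - β * M (2, 0) (0, 2) + β ^ 2 * M (2, 0) (2, 0))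
      + (M (0, 0) (0, 0) + M (0, 0) (1, 1) + M (0, 0) (2, 2) + M (1, 1) (0, 0) + M (1, 1) (1, 1)
        + M (1, 1) (2, 2) + M (2, 2) (0, 0) + M (2, 2) (1, 1) + M (2, 2) (2, 2))) := by
  rw [rhoBeta, Matrix.smul_mul, Matrix.trace_smul, smul_eq_mul]
  congr 1
  simp only [outer, Matrix.add_mul, Matrix.trace_add, Matrix.vecMulVec_mul, Matrix.trace_vecMulVec]
  simp [ket, Matrix.add_vecMul, Matrix.sub_vecMul, Matrix.smul_vecMul, add_dotProduct,
    sub_dotProduct]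
  ring

theorem posSemidef_rhoBeta (β : ℝ) : (rhoBeta β).PosSemidef := by
  refine Matrix.PosSemidef.smul ?_ (Complex.zero_le_real.2 (by positivity))
  exact ((Matrix.posSemidef_vecMulVec_self_star _).add
    (Matrix.posSemidef_vecMulVec_self_star _)).add (Matrix.posSemidef_vecMulVec_self_star _)

theorem isDensityMatrix_rhoBeta (β : ℝ) : IsDensityMatrix (rhoBeta β) := by
  refine ⟨posSemidef_rhoBeta β, ?_⟩
  have h : (5 + 2 * β ^ 2 : ℂ) ≠ 0 := by
    have : (5 + 2 * β ^ 2 : ℝ) ≠ 0 := by positivity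
    exact_mod_cast this
  rw [← Matrix.mul_one (rhoBeta β), trace_rhoBeta_mul]
  simp
  field_simp
  ring

theorem star_rhoBeta_apply (β : ℝ) (q r : Fin 3 × Fin 3) :
    star (rhoBeta β q r) = rhoBeta β q r := by
  have h : ∀ ψ : Fin 3 × Fin 3 → ℂ, star ψ = ψ → star (outer ψ q r) = outer ψ q r := by
    intro ψ hψ
    rw [outer, hψ, Matrix.vecMulVec_apply, star_mul', ← Pi.star_apply, ← Pi.star_apply, hψ]
  have hk : ∀ i j, star (ket i j) = ket i j := fun i j => by
    rw [ket, ← Pi.single_star, star_one]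
  simp only [rhoBeta, Matrix.smul_apply, Matrix.add_apply, smul_eq_mul, star_mul', star_add]
  rw [h, h, h] <;> simp [hk]

/-- If the diagonal entry at `|i j⟩` of a separable state vanishes, then so does the
entry at `|i k⟩⟨l j|`. -/
theorem IsSeparableState.apply_eq_zero {d : ℕ} {ρ : BipartiteOp d} (h : IsSeparableState ρ)
    {i j : Fin d} (h0 : ρ (i, j) (i, j) = 0) (k l : Fin d) : ρ (i, k) (l, j) = 0 := by
  obtain ⟨m, a, b, -, rfl⟩ := h.exists_eq_sum_vecMulVec
  have h1 : ∀ x, 0 ≤ Matrix.vecMulVec (prodVec (a x) (b x)) (star (prodVec (a x) (b x)))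
      (i, j) (i, j) := fun x => (Matrix.posSemidef_vecMulVec_self_star _).diag_nonneg
  rw [Matrix.sum_apply, Finset.sum_eq_zero_iff_of_nonneg fun x _ => h1 x] at h0
  rw [Matrix.sum_apply]
  refine Finset.sum_eq_zero fun x hx => ?_
  have h2 := h0 x hx
  simp only [Matrix.vecMulVec_apply, prodVec, Pi.star_apply, star_mul', Complex.star_def] at h2 ⊢
  have h3 : a x i = 0 ∨ b x j = 0 := by
    simpa using h2
  rcases h3 with h3 | h3 <;> simp [h3]

/-- The ket `|12⟩` occurs in none of the `εᵢ`, yet `ε₃` carries the coherence `|11⟩⟨22|`, which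
separability would force to vanish. In effect the partial transpose has a zero diagonal entry in a
nonzero row. -/
theorem isEntangledState_rhoBeta (β : ℝ) : IsEntangledState (rhoBeta β) := by
  refine ⟨isDensityMatrix_rhoBeta β, fun h => ?_⟩
  have h0 : rhoBeta β (1, 2) (1, 2) = 0 := by
    simp [rhoBeta, outer, ket, Matrix.vecMulVec_apply]
  have h1 := h.apply_eq_zero h0 1 2
  have h2 : (5 + 2 * β ^ 2 : ℂ) ≠ 0 := by
    have : (5 + 2 * β ^ 2 : ℝ) ≠ 0 := by positivity
    exact_mod_cast this
  simp [rhoBeta, outer, ket, Matrix.vecMulVec_apply, h2] at h1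

end rhoBeta

/-- In dimension three the criterion detects no state at all. -/
theorem not_detectedByDV_three {GA GB : Fin 3 × Fin 3 → Matrix (Fin 3) (Fin 3) ℂ}
    (hA : IsCanonicalBasis GA) (hB : IsCanonicalBasis GB) {ρ : BipartiteOp 3}
    (hρ : IsDensityMatrix ρ) : ¬ DetectedByDV GA GB ρ := by
  rw [DetectedByDV, not_lt]
  have h1 := traceNorm_sq_le (correlationMatrix GA GB ρ)
  have h2 := (sum_norm_correlationMatrix_sq_le hA hB ρ).trans hρ.sum_norm_sq_le
  have h3 : dvBound 3 = 3 := by norm_num [dvBound]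
  rw [h3]
  simp only [Fintype.card_prod, Fintype.card_fin] at h1
  push_cast at h1
  nlinarith

/-- The `εᵢ` have disjoint supports, so the quadratic form splits into three blocks. Their norms
squared are `1 + β²`, `1 + β²` and `3`, and `β² ≤ 1` makes `3` the largest. -/
theorem lambdaMax_rhoBeta_le {β : ℝ} (h0 : 0 ≤ β) (h1 : β ≤ 1) :
    lambdaMax (rhoBeta β) ≤ 3 / (5 + 2 * β ^ 2) := by
  refine lambdaMax_le (posSemidef_rhoBeta β).1 fun x => ?_
  have e : (star x ⬝ᵥ ((rhoBeta β).mulVec x)).re = 1 / (5 + 2 * β ^ 2) *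
      (Complex.normSq (x (0, 1) - β * x (1, 0)) + Complex.normSq (x (0, 2) - β * x (2, 0))
        + Complex.normSq (x (0, 0) + x (1, 1) + x (2, 2))) := by
    have h : star x ⬝ᵥ ((rhoBeta β).mulVec x) = (rhoBeta β * Matrix.vecMulVec x (star x)).trace := by
      rw [Matrix.mul_vecMulVec, Matrix.trace_vecMulVec, dotProduct_comm]
    rw [h, trace_rhoBeta_mul, Complex.re_ofReal_mul]
    congr 1
    simp [Matrix.vecMulVec_apply, Complex.normSq_apply, ← Complex.ofReal_pow]
    ring
  have hN : 0 < 1 / (5 + 2 * β ^ 2) := by positivity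
  have hb : β ^ 2 ≤ 1 := by nlinarith
  have two : ∀ u v : ℂ, Complex.normSq (u - β * v) ≤ 3 * (Complex.normSq u + Complex.normSq v) := by
    intro u v
    simp only [Complex.normSq_apply, Complex.sub_re, Complex.sub_im, Complex.re_ofReal_mul,
      Complex.im_ofReal_mul]
    nlinarith [sq_nonneg (β * u.re + v.re), sq_nonneg (β * u.im + v.im), sq_nonneg u.re,
      sq_nonneg v.re, sq_nonneg u.im, sq_nonneg v.im, mul_nonneg (sub_nonneg.2 hb) (sq_nonneg u.re),
      mul_nonneg (sub_nonneg.2 hb) (sq_nonneg v.re), mul_nonneg (sub_nonneg.2 hb) (sq_nonneg u.im),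
      mul_nonneg (sub_nonneg.2 hb) (sq_nonneg v.im)]
  have three : ∀ u v w : ℂ, Complex.normSq (u + v + w) ≤
      3 * (Complex.normSq u + Complex.normSq v + Complex.normSq w) := by
    intro u v w
    simp only [Complex.normSq_apply, Complex.add_re, Complex.add_im]
    nlinarith [sq_nonneg (u.re - v.re), sq_nonneg (u.re - w.re), sq_nonneg (v.re - w.re),
      sq_nonneg (u.im - v.im), sq_nonneg (u.im - w.im), sq_nonneg (v.im - w.im)]
  rw [e, div_eq_mul_one_div (3 : ℝ), mul_comm (3 : ℝ), mul_assoc]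
  refine mul_le_mul_of_nonneg_left ?_ hN.le
  simp only [Fintype.sum_prod_type, Fin.sum_univ_three, ← Complex.normSq_eq_norm_sq]
  have := two (x (0, 1)) (x (1, 0))
  have := two (x (0, 2)) (x (2, 0))
  have := three (x (0, 0)) (x (1, 1)) (x (2, 2))
  have := Complex.normSq_nonneg (x (1, 2))
  have := Complex.normSq_nonneg (x (2, 1))
  linarith

theorem partialTraceA_rhoBeta (β : ℝ) :
    partialTraceA (rhoBeta β) = ((1 / (5 + 2 * β ^ 2) : ℝ) : ℂ) •
      Matrix.diagonal ![1 + 2 * (β : ℂ) ^ 2, 2, 2] := by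
  ext j l
  fin_cases j <;> fin_cases l <;>
    simp [partialTraceA, rhoBeta, outer, ket, Matrix.vecMulVec_apply, Fin.sum_univ_three,
      Pi.single_apply] <;>
    ring

theorem det_one_add_rhoBeta (β : ℝ) :
    (1 + rhoBeta β).det = (1 + ((1 / (5 + 2 * β ^ 2) : ℝ) : ℂ) * (1 + β ^ 2)) ^ 2 *
      (1 + ((1 / (5 + 2 * β ^ 2) : ℝ) : ℂ) * 3) := by
  let ε : Fin 3 → Fin 3 × Fin 3 → ℂ :=
    ![ket 0 1 - (β : ℂ) • ket 1 0, ket 0 2 - (β : ℂ) • ket 2 0, ket 0 0 + ket 1 1 + ket 2 2]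
  -- Sylvester's identity replaces the `9 × 9` determinant by that of the `3 × 3` Gram matrix of the
  -- `εᵢ`, diagonal by orthogonality.
  have h : rhoBeta β = Matrix.of (fun q k => ε k q) *
      Matrix.of (fun k q => ((1 / (5 + 2 * β ^ 2) : ℝ) : ℂ) * star (ε k q)) := by
    ext q r
    simp only [rhoBeta, outer, Matrix.mul_apply, Fin.sum_univ_three, Matrix.of_apply,
      Matrix.smul_apply, Matrix.add_apply, Matrix.vecMulVec_apply, Pi.star_apply, smul_eq_mul]
    simp only [ε, Matrix.cons_val]
    ring
  have h2 : Matrix.of (fun k q => ((1 / (5 + 2 * β ^ 2) : ℝ) : ℂ) * star (ε k q)) *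
      Matrix.of (fun q k => ε k q) =
      ((1 / (5 + 2 * β ^ 2) : ℝ) : ℂ) • Matrix.diagonal ![1 + (β : ℂ) ^ 2, 1 + (β : ℂ) ^ 2, 3] := by
    ext k l
    rw [Matrix.mul_apply, Fintype.sum_prod_type]
    fin_cases k <;> fin_cases l <;>
      simp [ε, ket, Fin.sum_univ_three, Pi.single_apply] <;>
      ring
  rw [h, Matrix.det_one_add_mul_comm, h2, Matrix.det_fin_three]
  simp
  exact Or.inl (by ring)

theorem detGap_rhoBeta (β : ℝ) :
    detGap (rhoBeta β) = ((6 + 4 * β ^ 2 - 8 * β ^ 4 - 2 * β ^ 6) / (5 + 2 * β ^ 2) ^ 3 : ℝ) := by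
  have h : (5 + 2 * β ^ 2 : ℂ) ≠ 0 := by
    have : (5 + 2 * β ^ 2 : ℝ) ≠ 0 := by positivity
    exact_mod_cast this
  rw [detGap, det_one_add_rhoBeta, partialTraceA_rhoBeta, Matrix.det_fin_three]
  simp
  field_simp
  ring

/-- The lone `(√2)⁻¹` comes from pairing `I/√3` with `τ₈/√2`: these entries of `C` meet the
coherences between `|00⟩` and `|22⟩`. Elsewhere the normalizations pair up to rational numbers. -/
theorem trace_correlationMatrix_rhoBeta_mul (β : ℝ) :
    (correlationMatrix gellMannBasis gellMannBasis (rhoBeta β) * rhoBeta β).trace =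
      ((7 / 2 - 3 * β + β ^ 2 / 2 + (1 + β ^ 2) / 3 * (√2)⁻¹) / (5 + 2 * β ^ 2) ^ 2 : ℝ) := by
  have h2 := ofReal_sqrt_two_inv_mul_self
  have h3 := ofReal_sqrt_three_inv_mul_self
  have h : (5 + 2 * β ^ 2 : ℂ) ≠ 0 := by
    have : (5 + 2 * β ^ 2 : ℝ) ≠ 0 := by positivity
    exact_mod_cast this
  rw [Matrix.trace_mul_comm, trace_rhoBeta_mul]
  simp only [correlationMatrix, Matrix.of_apply, trace_rhoBeta_mul, Matrix.kroneckerMap_apply]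
  simp [gellMannBasis, gellMann]
  rw [div_eq_mul_inv, ← inv_pow]
  generalize ((√2 : ℝ) : ℂ)⁻¹ = s at *
  generalize ((√3 : ℝ) : ℂ)⁻¹ = u at *
  generalize (5 + 2 * (β : ℂ) ^ 2)⁻¹ = c at *
  rw [← sq] at h2 h3
  ring_nf
  simp only [h2, h3, Complex.I_sq]
  ring

theorem witnessValue_rhoBeta_re_neg {β : ℝ} (h0 : 0.7308 ≤ β) (h1 : β ≤ 0.7889) :
    (witnessValue gellMannBasis gellMannBasis (rhoBeta β)).re < 0 := by
  have hρ := isDensityMatrix_rhoBeta β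
  rw [witnessValue_re hρ, detGap_rhoBeta, trace_correlationMatrix_rhoBeta_mul, Complex.ofReal_re,
    Complex.ofReal_re]
  have hr : 0.707106 ≤ (√2)⁻¹ := by
    rw [le_inv_comm₀ (by norm_num) (by positivity), Real.sqrt_le_left (by norm_num)]
    norm_num
  have hN : 0 < 5 + 2 * β ^ 2 := by positivity
  set Q := 7 / 2 - 3 * β + β ^ 2 / 2 + (1 + β ^ 2) / 3 * (√2)⁻¹ with hQ
  have hQ1 : 7 / 2 - 3 * β + β ^ 2 / 2 + (1 + β ^ 2) / 3 * 0.707106 ≤ Q := by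
    rw [hQ]
    gcongr
  have hQ0 : 0 < Q := by nlinarith [sq_nonneg β]
  have hlam : (5 + 2 * β ^ 2) / 3 ≤ 1 / lambdaMax (rhoBeta β) := by
    rw [le_one_div (by positivity) hρ.lambdaMax_pos, one_div_div]
    exact lambdaMax_rhoBeta_le (by linarith) (by linarith)
  have h2 : (5 + 2 * β ^ 2) / 3 * (Q / (5 + 2 * β ^ 2) ^ 2) ≤
      1 / lambdaMax (rhoBeta β) * (Q / (5 + 2 * β ^ 2) ^ 2) :=
    mul_le_mul_of_nonneg_right hlam (by positivity)
  -- This is the upper bound for the witness value multiplied by `3(5+2β²)³`, so `432 = 3 · 144`.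
  have h3 : 9 * (5 + 2 * β ^ 2) ^ 3 - 432 * (6 + 4 * β ^ 2 - 8 * β ^ 4 - 2 * β ^ 6)
      - Q * (5 + 2 * β ^ 2) ^ 2 < 0 := by
    have h4 := mul_le_mul_of_nonneg_right hQ1 (sq_nonneg (5 + 2 * β ^ 2))
    refine lt_of_le_of_lt (sub_le_sub_left h4 _) ?_
    -- The expression is barely negative (about `-0.07`) at the right endpoint, hence the expansion
    -- there. The interval has length below `0.06`, and the linear term in `s` is negative enough to
    -- absorb the higher powers.
    obtain ⟨s, rfl⟩ : ∃ s, β = 0.7889 - s := ⟨0.7889 - β, by ring⟩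
    have s0 : 0 ≤ s := by linarith
    have s1 : s ≤ 0.06 := by linarith
    have s2 : s ^ 2 ≤ 0.06 * s := by nlinarith
    have s3 : 0 ≤ s ^ 3 := by positivity
    have s4 : s ^ 4 ≤ 0.06 * s := by nlinarith
    have s5 : 0 ≤ s ^ 5 := by positivity
    have s6 : s ^ 6 ≤ 0.06 * s := by nlinarith
    linarith
  have h5 : dvBound 3 - ((3 : ℕ) : ℝ) ^ 2 * (((3 : ℕ) : ℝ) + 1) ^ 2 *
        ((6 + 4 * β ^ 2 - 8 * β ^ 4 - 2 * β ^ 6) / (5 + 2 * β ^ 2) ^ 3)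
      - (5 + 2 * β ^ 2) / 3 * (Q / (5 + 2 * β ^ 2) ^ 2) =
      (9 * (5 + 2 * β ^ 2) ^ 3 - 432 * (6 + 4 * β ^ 2 - 8 * β ^ 4 - 2 * β ^ 6)
      - Q * (5 + 2 * β ^ 2) ^ 2) / (3 * (5 + 2 * β ^ 2) ^ 3) := by
    rw [dvBound]
    field_simp
    push_cast
    ring
  have h6 := div_neg_of_neg_of_pos h3 (by positivity : 0 < 3 * (5 + 2 * β ^ 2) ^ 3)
  linarith

theorem theorem6 :
    (∀ d : ℕ, 2 ≤ d → ∀ GA GB : Fin d × Fin d → Matrix (Fin d) (Fin d) ℂ,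
      IsCanonicalBasis GA → IsCanonicalBasis GB →
        (∀ ρ : BipartiteOp d, IsSeparableState ρ →
          traceNorm (correlationMatrix GA GB ρ) ≤ dvBound d ∧
          0 ≤ (witnessValue GA GB ρ).re) ∧
        (∃ ρ : BipartiteOp d, IsEntangledState ρ ∧ (witnessValue GA GB ρ).re < 0 ∧
          ((∀ a, (GA a).IsHermitian) → (∀ a, (GB a).IsHermitian) →
            (witnessValue GA GB ρ).im = 0 ∧
            (GA = GB → (witnessDV GA GB ρ).IsHermitian)))) ∧
    (IsCanonicalBasis gellMannBasis ∧ ∀ a, (gellMannBasis a).IsHermitian) ∧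
    (∀ β ∈ Set.Icc (1 / √2) (1 : ℝ),
      IsEntangledState (rhoBeta β) ∧ ¬ DetectedByDV gellMannBasis gellMannBasis (rhoBeta β)) ∧
    (∀ β ∈ Set.Icc (0.7308 : ℝ) 0.7889,
      (witnessValue gellMannBasis gellMannBasis (rhoBeta β)).im = 0 ∧
      (witnessValue gellMannBasis gellMannBasis (rhoBeta β)).re < 0) := by
  refine ⟨fun d hd GA GB hA hB => ⟨fun ρ hρ => ⟨?_, hρ.witnessValue_re_nonneg hd hA hB⟩, ?_⟩,
    ⟨isCanonicalBasis_gellMannBasis, isHermitian_gellMannBasis⟩, fun β _ => ?_, fun β hβ => ?_⟩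
  · exact (hρ.traceNorm_correlationMatrix_le hA hB).trans (one_le_dvBound hd)
  · refine ⟨maxEntangled d, isEntangledState_maxEntangled hd hA hB,
      witnessValue_maxEntangled_re_neg hd hA hB, fun hA' hB' => ⟨?_, ?_⟩⟩
    · exact witnessValue_im hA' hB' (isDensityMatrix_maxEntangled hd) star_maxEntangled_apply
    · rintro rfl
      exact isHermitian_witnessDV_maxEntangled hd hA'
  · exact ⟨isEntangledState_rhoBeta β, not_detectedByDV_three isCanonicalBasis_gellMannBasis
      isCanonicalBasis_gellMannBasis (isDensityMatrix_rhoBeta β)⟩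
  · exact ⟨witnessValue_im isHermitian_gellMannBasis isHermitian_gellMannBasis
      (isDensityMatrix_rhoBeta β) (star_rhoBeta_apply β), witnessValue_rhoBeta_re_neg hβ.1 hβ.2⟩
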